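/- A 0-1 matrix $M$ contains a 0-1 matrix $P$ if some submatrix of $M$ (obtained by deleting rows and columns) either equals $P$ or can be turned into $P$ by changing some ones to zeroes; otherwise $M$ avoids $P$. Let $\mathrm{ex}(n,P)$ be the maximum number of ones in an $n\times n$ 0-1 matrix that avoids $P$ (taken to be $0$ if every $n \times n$ 0-1 matrix contains $P$). A 0-1 matrix $P$ is called minimally non-linear if $\mathrm{ex}(n,P)=\omega(n)$ but $\mathrm{ex}(n,P')=O(n)$ for every 0-1 matrix $P'\neq P$ that is contained in $P$. For every integer $k>2$, there are only finitely many minimally non-linear 0-1 matrices with $k$ rows (and any number of columns), and their number is at most $$\sum_{i=\lceil (k+2)/4\rceil}^{4k-2}\bigl(i^k-(i-1)^k\bigr)\,k^{i-1}.$$ -/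

import Mathlib

open Filter Asymptotics
open scoped Classical

namespace ZeroOne

/-- A 0-1 matrix with `m` rows and `n` columns; the entry `true` is a one, `false` is a zero. -/
abbrev Mat (m n : ℕ) : Type := Matrix (Fin m) (Fin n) Bool

/-- `M` contains `P`: some submatrix of `M` (rows `f`, columns `g`, in their order) equals `P` or
turns into `P` when some of its ones are changed to zeroes. -/
def Contains {m n a b : ℕ} (M : Mat m n) (P : Mat a b) : Prop :=
  ∃ (f : Fin a → Fin m) (g : Fin b → Fin n), StrictMono f ∧ StrictMono g ∧
    ∀ i j, P i j = true → M (f i) (g j) = true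

/-- `P` is contained in `M` and different from `M`. (Containment is antisymmetric, so being
different from `M` means not containing `M`.) -/
def StrictlyContains {m n a b : ℕ} (M : Mat m n) (P : Mat a b) : Prop :=
  Contains M P ∧ ¬ Contains P M

/-- The number of ones of a 0-1 matrix. -/
def ones {m n : ℕ} (M : Mat m n) : ℕ :=
  (Finset.univ.filter fun p : Fin m × Fin n => M p.1 p.2 = true).card

/-- `ex n P`: the maximum number of ones in an `n × n` 0-1 matrix that avoids `P`
(and `0` if there is no such matrix). -/
noncomputable def ex (n : ℕ) {a b : ℕ} (P : Mat a b) : ℕ :=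
  (Finset.univ.filter fun M : Mat n n => ¬ Contains M P).sup ones

/-- `ex n P = O(n)` as `n → ∞`. -/
def Linear {a b : ℕ} (P : Mat a b) : Prop :=
  (fun n : ℕ => (ex n P : ℝ)) =O[atTop] (fun n : ℕ => (n : ℝ))

/-- `ex n P = ω(n)` as `n → ∞`. -/
def Superlinear {a b : ℕ} (P : Mat a b) : Prop :=
  (fun n : ℕ => (n : ℝ)) =o[atTop] (fun n : ℕ => (ex n P : ℝ))

/-- `P` is minimally non-linear: `ex n P = ω(n)`, and `ex n P' = O(n)` for every `P'` strictly
contained in `P`. -/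
def MinimallyNonlinear {a b : ℕ} (P : Mat a b) : Prop :=
  Superlinear P ∧ ∀ (a' b' : ℕ) (P' : Mat a' b'), StrictlyContains P P' → Linear P'

/-- The set of all minimally non-linear 0-1 matrices with `k` rows, of any number `c` of
columns. -/
def minimallyNonlinearWithRows (k : ℕ) : Set (Σ c : ℕ, Mat k c) :=
  {P | MinimallyNonlinear P.2}

end ZeroOne

namespace ZeroOne

/-! ### Containment, numbers of ones, and the extremal function -/

/-! Three two-row patterns are non-linear: the full 2 × 2 square, `logPattern` and
`alternatingPattern`. The first two are avoided by the matrix of differences that are powers of two,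
with order n log n ones; the third by a doubly recursive construction of Davenport–Schinzel type
(`Layered`). A minimally non-linear P with more than two rows does not fit into a two-row matrix, so
by minimality it contains none of these patterns or their reflections. Hence each column has at most
one one that is not the last of its row and at most one that is not the first, and distinct rows
never alternate (`Unobstructed`).

Minimality also forbids empty rows and columns, and a column whose single one lies between ones of
the same row in the two neighbouring columns: deleting such columns preserves non-linearity. Label
each column by a row with a one in it. For a suitable choice this is a word on k letters without a
subsequence abab and without three equal consecutive letters, so its length is at most 2(2k - 1) =
4k - 2. Applied to the transpose, this gives k ≤ 4c - 2 for c columns.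

For fixed c, P is determined by the last one of each row, where some row ends in the last column
(c^k - (c-1)^k choices), and by the row of the non-final one, if any, in each of the other c - 1
columns (k^(c-1) choices). -/

theorem Contains.card_le {m n a b : ℕ} {M : Mat m n} {P : Mat a b} (h : Contains M P) :
    a ≤ m ∧ b ≤ n := by
  obtain ⟨f, g, hf, hg, -⟩ := h
  exact ⟨by simpa using Fintype.card_le_of_injective f hf.injective,
    by simpa using Fintype.card_le_of_injective g hg.injective⟩

theorem Contains.transpose {m n a b : ℕ} {M : Mat m n} {P : Mat a b} (h : Contains M P) :
    Contains M.transpose P.transpose := by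
  obtain ⟨f, g, hf, hg, hP⟩ := h
  exact ⟨g, f, hg, hf, fun i j hij => hP j i hij⟩

theorem Contains.revRows {m n a b : ℕ} {M : Mat m n} {P : Mat a b} (h : Contains M P) :
    Contains (M.submatrix Fin.rev id) (P.submatrix Fin.rev id) := by
  obtain ⟨f, g, hf, hg, hP⟩ := h
  refine ⟨fun i => (f i.rev).rev, g, fun i j hij => Fin.rev_lt_rev.2 (hf (Fin.rev_lt_rev.2 hij)),
    hg, fun i j hij => ?_⟩
  simpa using hP _ _ hij

theorem Contains.revCols {m n a b : ℕ} {M : Mat m n} {P : Mat a b} (h : Contains M P) :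
    Contains (M.submatrix id Fin.rev) (P.submatrix id Fin.rev) := by
  obtain ⟨f, g, hf, hg, hP⟩ := h
  refine ⟨f, fun i => (g i.rev).rev, hf,
    fun i j hij => Fin.rev_lt_rev.2 (hg (Fin.rev_lt_rev.2 hij)), fun i j hij => ?_⟩
  simpa using hP _ _ hij

theorem contains_submatrix {m n a b : ℕ} (M : Mat m n) {f : Fin a → Fin m} {g : Fin b → Fin n}
    (hf : StrictMono f) (hg : StrictMono g) : Contains M (M.submatrix f g) :=
  ⟨f, g, hf, hg, fun _ _ h => h⟩

theorem ones_comp_equiv {m n m' n' : ℕ} (M : Mat m n) (M' : Mat m' n')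
    (e : Fin m × Fin n ≃ Fin m' × Fin n')
    (h : ∀ p, M p.1 p.2 = M' (e p).1 (e p).2) : ones M = ones M' := by
  unfold ones
  refine Finset.card_equiv e fun p => ?_
  simp [h p]

theorem ones_transpose {m n : ℕ} (M : Mat m n) : ones M.transpose = ones M :=
  ones_comp_equiv _ _ (Equiv.prodComm _ _) fun _ => rfl

theorem ones_revRows {m n : ℕ} (M : Mat m n) : ones (M.submatrix Fin.rev id) = ones M :=
  ones_comp_equiv _ _ (Fin.revPerm.prodCongr (Equiv.refl _)) fun _ => rfl

theorem ones_revCols {m n : ℕ} (M : Mat m n) : ones (M.submatrix id Fin.rev) = ones M :=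
  ones_comp_equiv _ _ ((Equiv.refl _).prodCongr Fin.revPerm) fun _ => rfl

theorem ones_le {m n : ℕ} (M : Mat m n) : ones M ≤ m * n :=
  (Finset.card_le_univ _).trans (by simp)

theorem ones_le_ex {n a b : ℕ} {P : Mat a b} {M : Mat n n} (h : ¬ Contains M P) :
    ones M ≤ ex n P :=
  Finset.le_sup (f := ones) (by simpa using h)

theorem ex_le {n a b : ℕ} {P : Mat a b} {N : ℕ}
    (h : ∀ M : Mat n n, ¬ Contains M P → ones M ≤ N) : ex n P ≤ N :=
  Finset.sup_le fun M hM => h M (by simpa using hM)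

theorem ex_le_ex_of_map {n a b a' b' : ℕ} {P : Mat a b} {P' : Mat a' b'} (φ : Mat n n → Mat n n)
    (hφ : ∀ M, ones (φ M) = ones M) (h : ∀ M, Contains (φ M) P' → Contains M P) :
    ex n P ≤ ex n P' :=
  ex_le fun M hM => hφ M ▸ ones_le_ex fun h' => hM (h M h')

theorem ex_transpose {a b : ℕ} (n : ℕ) (P : Mat a b) : ex n P.transpose = ex n P :=
  le_antisymm
    (ex_le_ex_of_map Matrix.transpose ones_transpose fun _ h => h.transpose)
    (ex_le_ex_of_map Matrix.transpose ones_transpose fun _ h => h.transpose)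

theorem ex_revRows {a b : ℕ} (n : ℕ) (P : Mat a b) : ex n (P.submatrix Fin.rev id) = ex n P :=
  le_antisymm
    (ex_le_ex_of_map (fun M => M.submatrix Fin.rev id) ones_revRows fun M h => by
      convert h.revRows using 1; ext; simp)
    (ex_le_ex_of_map (fun M => M.submatrix Fin.rev id) ones_revRows fun M h => by
      convert h.revRows using 1 <;> (ext; simp))

theorem ex_revCols {a b : ℕ} (n : ℕ) (P : Mat a b) : ex n (P.submatrix id Fin.rev) = ex n P :=
  le_antisymm
    (ex_le_ex_of_map (fun M => M.submatrix id Fin.rev) ones_revCols fun M h => by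
      convert h.revCols using 1; ext; simp)
    (ex_le_ex_of_map (fun M => M.submatrix id Fin.rev) ones_revCols fun M h => by
      convert h.revCols using 1 <;> (ext; simp))

theorem linear_transpose {a b : ℕ} (P : Mat a b) : Linear P.transpose ↔ Linear P := by
  simp only [Linear, ex_transpose]

theorem linear_revRows {a b : ℕ} (P : Mat a b) :
    Linear (P.submatrix Fin.rev id) ↔ Linear P := by
  simp only [Linear, ex_revRows]

theorem linear_revCols {a b : ℕ} (P : Mat a b) :
    Linear (P.submatrix id Fin.rev) ↔ Linear P := by
  simp only [Linear, ex_revCols]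

theorem MinimallyNonlinear.transpose {a b : ℕ} {P : Mat a b} (h : MinimallyNonlinear P) :
    MinimallyNonlinear P.transpose := by
  refine ⟨by simpa only [Superlinear, ex_transpose] using h.1, fun a' b' P' hP' => ?_⟩
  rw [← linear_transpose]
  exact h.2 _ _ _ ⟨hP'.1.transpose, fun h' => hP'.2 h'.transpose⟩

theorem Superlinear.not_linear {a b : ℕ} {P : Mat a b} (h : Superlinear P) : ¬ Linear P := by
  intro h'
  refine isLittleO_irrefl ?_ (h.trans_isBigO h')
  refine (Eventually.frequently ?_ : ∃ᶠ n : ℕ in atTop, (n : ℝ) ≠ 0)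
  filter_upwards [eventually_ge_atTop 1] with n hn
  exact_mod_cast Nat.one_le_iff_ne_zero.1 hn

/-- A non-linear `Q` contained in `P` cannot be strictly contained, so it contains `P` in turn. -/
theorem MinimallyNonlinear.not_linear_imp {a b : ℕ} {P : Mat a b} (h : MinimallyNonlinear P)
    {a' b' : ℕ} {Q : Mat a' b'} (hQ : ¬ Linear Q) (hc : Contains P Q) : a ≤ a' ∧ b ≤ b' := by
  by_contra hab
  exact hQ (h.2 _ _ _ ⟨hc, fun h' => hab h'.card_le⟩)

/-- Avoiding matrices of unbounded density witness non-linearity. -/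
theorem not_linear_of_forall_exists {a b : ℕ} {P : Mat a b}
    (h : ∀ C : ℕ, ∃ (n : ℕ) (M : Mat n n), ¬ Contains M P ∧ C * n < ones M) : ¬ Linear P := by
  intro hl
  obtain ⟨c, hc⟩ := hl.bound
  obtain ⟨N, hN⟩ := eventually_atTop.1 hc
  obtain ⟨C, hC⟩ := exists_nat_ge (max c N)
  obtain ⟨n, M, hM, hlt⟩ := h C
  -- No largeness of `n` is assumed: more than `C * n` ones among `n * n` entries force `n > C ≥ N`.
  have hn : C < n := by
    by_contra hn
    have := ones_le M
    have : n * n ≤ C * n := Nat.mul_le_mul_right _ (not_lt.1 hn)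
    omega
  have hNC : N ≤ C := by exact_mod_cast (le_max_right _ _).trans hC
  have h1 := hN n (by omega)
  simp only [Real.norm_natCast] at h1
  have h2 : (C * n : ℝ) < ex n P := by exact_mod_cast hlt.trans_le (ones_le_ex hM)
  have h3 : c * n ≤ C * n :=
    mul_le_mul_of_nonneg_right ((le_max_left _ _).trans hC) (Nat.cast_nonneg n)
  linarith

/-- If every matrix avoiding `P` is covered, up to `K n` ones, by `q` matrices avoiding `P₀`, then
linearity passes from `P₀` to `P`. -/
theorem Linear.of_cover {a b a' b' : ℕ} {P : Mat a b} {P₀ : Mat a' b'} (h₀ : Linear P₀)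
    (q K N : ℕ) (h : ∀ n, N ≤ n → ∀ M : Mat n n, ¬ Contains M P →
      ∃ F : Fin q → Mat n n, (∀ p, ¬ Contains (F p) P₀) ∧ ones M ≤ ∑ p, ones (F p) + K * n) :
    Linear P := by
  have hex : ∀ n, N ≤ n → ex n P ≤ q * ex n P₀ + K * n := by
    intro n hn
    refine ex_le fun M hM => ?_
    obtain ⟨F, hF, hle⟩ := h n hn M hM
    have : ∑ p, ones (F p) ≤ ∑ _p : Fin q, ex n P₀ := Finset.sum_le_sum fun p _ => ones_le_ex (hF p)
    simp only [Finset.sum_const, Finset.card_univ, Fintype.card_fin, smul_eq_mul] at this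
    omega
  have h1 : (fun n : ℕ => (q : ℝ) * (ex n P₀ : ℝ) + K * (n : ℝ)) =O[atTop]
      (fun n : ℕ => (n : ℝ)) :=
    (IsBigO.const_mul_left h₀ _).add ((isBigO_refl _ _).const_mul_left _)
  refine IsBigO.trans (IsBigO.of_bound 1 ?_) h1
  filter_upwards [eventually_ge_atTop N] with n hn
  have h2 : (ex n P : ℝ) ≤ q * ex n P₀ + K * n := by exact_mod_cast hex n hn
  rw [Real.norm_of_nonneg (Nat.cast_nonneg _), one_mul]
  exact h2.trans (le_abs_self _)

/-! ### Sequences without long runs and without alternations `a b a b` -/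

/-- The set `E` of ends of maximal runs has at most 2k - 1 elements, where k is the number of
letters, and every run has length at most two. -/
theorem length_le_of_no_alternation {α : Type*} [Fintype α] (u : ℕ → α) (b : ℕ)
    (h3 : ∀ x, x + 2 < b → u x = u (x + 1) → u (x + 1) ≠ u (x + 2))
    (h4 : ∀ w x y z, w < x → x < y → y < z → z < b → u w = u y → u x = u z → u w = u x) :
    b ≤ 2 * (2 * Fintype.card α - 1) := by
  rcases Nat.eq_zero_or_pos b with rfl | hb
  · exact Nat.zero_le _
  set E := (Finset.range b).filter fun x => x + 1 < b → u x ≠ u (x + 1)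
  set L := (Finset.range b).filter fun x => ∀ y, x < y → y < b → u y ≠ u x
  set A := (Finset.range b).filter fun x => ∀ y, y < x → u y ≠ u x
  have hL : L.card ≤ Fintype.card α := by
    refine Finset.card_le_card_of_injOn u (fun _ _ => Finset.mem_univ _) ?_
    intro x hx y hy hxy
    simp only [L, Finset.coe_filter, Finset.mem_range, Set.mem_ofPred_eq] at hx hy
    rcases lt_trichotomy x y with h | h | h
    · exact absurd hxy.symm (hx.2 y h hy.1)
    · exact h
    · exact absurd hxy (hy.2 x h hx.1)
  have hA : A.card ≤ Fintype.card α := by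
    refine Finset.card_le_card_of_injOn u (fun _ _ => Finset.mem_univ _) ?_
    intro x hx y hy hxy
    simp only [A, Finset.coe_filter, Finset.mem_range, Set.mem_ofPred_eq] at hx hy
    rcases lt_trichotomy x y with h | h | h
    · exact absurd hxy (hy.2 x h)
    · exact h
    · exact absurd hxy.symm (hx.2 y h)
  have h0A : 0 ∈ A := by simp [A, hb]
  -- A run end is the last occurrence of its letter, or the next position is the first occurrence of
  -- its own; otherwise the two letters alternate. Position 0 is a first occurrence that follows no
  -- run end, which saves one.
  have hE : E ⊆ L ∪ (A.erase 0).image Nat.pred := by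
    intro x hx
    simp only [E, Finset.mem_filter, Finset.mem_range] at hx
    by_cases hxL : x ∈ L
    · exact Finset.mem_union_left _ hxL
    refine Finset.mem_union_right _ (Finset.mem_image.2 ⟨x + 1, ?_, rfl⟩)
    simp only [L, Finset.mem_filter, Finset.mem_range, hx.1, true_and, not_forall,
      not_not] at hxL
    obtain ⟨y, hxy, hyb, hy⟩ := hxL
    have hne := hx.2 (by omega)
    simp only [A, Finset.mem_erase, Finset.mem_filter, Finset.mem_range]
    refine ⟨by omega, by omega, fun w hw hwu => ?_⟩
    have hwx : w ≠ x := by rintro rfl; exact hne hwu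
    have hyx : y ≠ x + 1 := by rintro rfl; exact hne hy.symm
    exact hne ((h4 w x (x + 1) y (by omega) (by omega) (by omega) hyb hwu hy.symm).symm.trans hwu)
  have hEc : E.card ≤ 2 * Fintype.card α - 1 := by
    have h1 := (Finset.card_le_card hE).trans (Finset.card_union_le _ _)
    have h2 := Finset.card_image_le (s := A.erase 0) (f := Nat.pred)
    rw [Finset.card_erase_of_mem h0A] at h2
    have h3 := Finset.card_pos.2 ⟨0, h0A⟩
    omega
  have hcov : Finset.range b ⊆ E ∪ E.image Nat.pred := by
    intro x hx
    by_cases hxE : x ∈ E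
    · exact Finset.mem_union_left _ hxE
    refine Finset.mem_union_right _ (Finset.mem_image.2 ⟨x + 1, ?_, rfl⟩)
    simp only [E, Finset.mem_filter, hx, true_and, not_forall, not_not] at hxE
    obtain ⟨h1, h2⟩ := hxE
    simp only [E, Finset.mem_filter, Finset.mem_range]
    exact ⟨h1, fun h => h3 x h h2⟩
  have h1 := (Finset.card_le_card hcov).trans (Finset.card_union_le _ _)
  have h2 := Finset.card_image_le (s := E) (f := Nat.pred)
  rw [Finset.card_range] at h1
  omega

/-! ### Counting matrices in which each column has at most one non-final one of a row -/

theorem card_filter_exists_eq_last (k n : ℕ) :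
    (Finset.univ.filter fun f : Fin k → Fin (n + 1) => ∃ r, f r = Fin.last n).card =
      (n + 1) ^ k - n ^ k := by
  have h1 : (Finset.univ.filter fun f : Fin k → Fin (n + 1) => ∃ r, f r = Fin.last n) =
      Finset.univ \ Fintype.piFinset fun _ : Fin k => Finset.univ.erase (Fin.last n) := by
    ext f
    simp [Fintype.mem_piFinset]
  rw [h1, Finset.card_sdiff_of_subset (Finset.subset_univ _), Fintype.card_piFinset]
  simp

/-- A matrix is recovered from the last one of each row and from one chosen one in each column but
the last. -/
theorem card_le_of_unique_nonfinal {k n : ℕ} (A : Finset (Mat k (n + 1)))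
    (hrow : ∀ P ∈ A, ∀ r, ∃ c, P r c = true) (hcol : ∀ P ∈ A, ∀ c, ∃ r, P r c = true)
    (huniq : ∀ P ∈ A, ∀ r s c c' c'', P r c = true → P s c = true → c < c' → c < c'' →
      P r c' = true → P s c'' = true → r = s) :
    A.card ≤ ((n + 1) ^ k - n ^ k) * k ^ n := by
  set B := Finset.univ.filter fun f : Fin k → Fin (n + 1) => ∃ r, f r = Fin.last n
  let D : (Fin k → Fin (n + 1)) × (Fin n → Fin k) → Mat k (n + 1) := fun p r c =>
    decide (p.1 r = c ∨ ∃ c', c = Fin.castSucc c' ∧ p.2 c' = r)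
  have hsub : A ⊆ (B ×ˢ (Finset.univ : Finset (Fin n → Fin k))).image D := by
    intro P hP
    have hf : ∀ r, ∃ c, P r c = true ∧ ∀ c', P r c' = true → c' ≤ c := by
      intro r
      obtain ⟨c, hc⟩ := hrow P hP r
      have hne : (Finset.univ.filter fun c => P r c = true).Nonempty := ⟨c, by simpa using hc⟩
      refine ⟨_, by simpa using Finset.max'_mem _ hne, fun c' hc' => Finset.le_max' _ _ ?_⟩
      simpa using hc'
    choose f hfP hfmax using hf
    -- In a column without a non-final one any one may be chosen: it is then the last of its row, so
    -- marking it again is harmless.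
    have hg : ∀ c, ∃ r, P r c = true ∧ ∀ s, P s c = true → c < f s → s = r := by
      intro c
      by_cases h : ∃ s, P s c = true ∧ c < f s
      · obtain ⟨r, hr, hcr⟩ := h
        exact ⟨r, hr, fun s hs hcs => huniq P hP s r c _ _ hs hr hcs hcr (hfP s) (hfP r)⟩
      · obtain ⟨r, hr⟩ := hcol P hP c
        exact ⟨r, hr, fun s hs hcs => (h ⟨s, hs, hcs⟩).elim⟩
    choose g hgP hguniq using hg
    refine Finset.mem_image.2 ⟨(f, fun c => g c.castSucc), ?_, ?_⟩
    · simp only [Finset.mem_product, B, Finset.mem_filter, Finset.mem_univ, true_and, and_true]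
      obtain ⟨r, hr⟩ := hcol P hP (Fin.last n)
      exact ⟨r, le_antisymm (Fin.le_last _) (hfmax r _ hr)⟩
    · ext r c
      by_cases hPrc : P r c = true
      · rw [hPrc]
        simp only [D, decide_eq_true_eq]
        rcases (hfmax r c hPrc).eq_or_lt with h | h
        · exact Or.inl h.symm
        · have hc : c ≠ Fin.last n := (h.trans_le (Fin.le_last _)).ne
          refine Or.inr ⟨c.castPred hc, by simp, ?_⟩
          simpa using (hguniq c r hPrc h).symm
      · rw [Bool.not_eq_true] at hPrc
        rw [hPrc]
        simp only [D, decide_eq_false_iff_not, not_or, not_exists, not_and]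
        refine ⟨?_, ?_⟩
        · rintro rfl
          simp [hfP r] at hPrc
        · rintro c' rfl rfl
          simp [hgP] at hPrc
  calc A.card ≤ _ := Finset.card_le_card hsub
    _ ≤ _ := Finset.card_image_le
    _ = _ := by
      rw [Finset.card_product, card_filter_exists_eq_last]
      simp

/-! ### Two-row patterns -/

/-- The all-ones matrix of size `2 × 2`. -/
def fullPattern : Mat 2 2 := !![true, true; true, true]

/-- A two-row pattern whose extremal function is of order `n log n`. -/
def logPattern : Mat 2 3 := !![false, true, true; true, false, true]

/-- The alternating two-row pattern, related to Davenport–Schinzel sequences of order three. -/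
def alternatingPattern : Mat 2 4 := !![true, false, true, false; false, true, false, true]

theorem strictMono_vec_two {n : ℕ} {x y : Fin n} (h : x < y) : StrictMono ![x, y] := by
  rw [Fin.strictMono_iff_lt_succ]
  simpa [Fin.forall_fin_succ] using h

theorem strictMono_vec_three {n : ℕ} {x y z : Fin n} (h : x < y) (h' : y < z) :
    StrictMono ![x, y, z] := by
  rw [Fin.strictMono_iff_lt_succ]
  simp [Fin.forall_fin_succ, h, h']

theorem strictMono_vec_four {n : ℕ} {x y z w : Fin n} (h : x < y) (h' : y < z) (h'' : z < w) :
    StrictMono ![x, y, z, w] := by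
  rw [Fin.strictMono_iff_lt_succ]
  simp [Fin.forall_fin_succ, h, h', h'']

section Occurrences

variable {m n : ℕ} {P : Mat m n} {r s : Fin m} {x y z w : Fin n}

theorem contains_fullPattern (hrs : r < s) (hxy : x < y) (h1 : P r x = true) (h2 : P r y = true)
    (h3 : P s x = true) (h4 : P s y = true) : Contains P fullPattern :=
  ⟨![r, s], ![x, y], strictMono_vec_two hrs, strictMono_vec_two hxy, by
    simp [Fin.forall_fin_succ, fullPattern, *]⟩

theorem contains_logPattern (hrs : r < s) (hxy : x < y) (hyz : y < z) (h1 : P r y = true)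
    (h2 : P r z = true) (h3 : P s x = true) (h4 : P s z = true) : Contains P logPattern :=
  ⟨![r, s], ![x, y, z], strictMono_vec_two hrs, strictMono_vec_three hxy hyz, by
    simp [Fin.forall_fin_succ, logPattern, *]⟩

theorem contains_logPattern_revRows (hrs : r < s) (hxy : x < y) (hyz : y < z) (h1 : P s y = true)
    (h2 : P s z = true) (h3 : P r x = true) (h4 : P r z = true) :
    Contains P (logPattern.submatrix Fin.rev id) :=
  ⟨![r, s], ![x, y, z], strictMono_vec_two hrs, strictMono_vec_three hxy hyz, by
    simp [Fin.forall_fin_succ, logPattern, Fin.rev, *]⟩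

theorem contains_logPattern_revCols (hrs : r < s) (hxy : x < y) (hyz : y < z) (h1 : P r x = true)
    (h2 : P r y = true) (h3 : P s x = true) (h4 : P s z = true) :
    Contains P (logPattern.submatrix id Fin.rev) :=
  ⟨![r, s], ![x, y, z], strictMono_vec_two hrs, strictMono_vec_three hxy hyz, by
    simp [Fin.forall_fin_succ, logPattern, Fin.rev, *]⟩

theorem contains_logPattern_revRows_revCols (hrs : r < s) (hxy : x < y) (hyz : y < z)
    (h1 : P s x = true) (h2 : P s y = true) (h3 : P r x = true) (h4 : P r z = true) :
    Contains P ((logPattern.submatrix id Fin.rev).submatrix Fin.rev id) :=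
  ⟨![r, s], ![x, y, z], strictMono_vec_two hrs, strictMono_vec_three hxy hyz, by
    simp [Fin.forall_fin_succ, logPattern, Fin.rev, *]⟩

theorem contains_alternatingPattern (hrs : r < s) (hxy : x < y) (hyz : y < z) (hzw : z < w)
    (h1 : P r x = true) (h2 : P s y = true) (h3 : P r z = true) (h4 : P s w = true) :
    Contains P alternatingPattern :=
  ⟨![r, s], ![x, y, z, w], strictMono_vec_two hrs, strictMono_vec_four hxy hyz hzw, by
    simp [Fin.forall_fin_succ, alternatingPattern, *]⟩

theorem contains_alternatingPattern_revRows (hrs : r < s) (hxy : x < y) (hyz : y < z) (hzw : z < w)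
    (h1 : P s x = true) (h2 : P r y = true) (h3 : P s z = true) (h4 : P r w = true) :
    Contains P (alternatingPattern.submatrix Fin.rev id) :=
  ⟨![r, s], ![x, y, z, w], strictMono_vec_two hrs, strictMono_vec_four hxy hyz hzw, by
    simp [Fin.forall_fin_succ, alternatingPattern, Fin.rev, *]⟩

end Occurrences

/-! ### The matrix of differences that are powers of two -/

/-- The matrix with a one at `(i, j)` exactly when `j - i` is a power of two. -/
noncomputable def powMatrix (n : ℕ) : Mat n n := fun i j => decide (∃ a : ℕ, (j : ℕ) = i + 2 ^ a)

theorem powMatrix_eq_true {n : ℕ} {i j : Fin n} :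
    powMatrix n i j = true ↔ ∃ a : ℕ, (j : ℕ) = i + 2 ^ a := by
  simp [powMatrix]

/-- With `j - i = 2 ^ a`, the smaller powers of two `j - i'` and `y - i` are at most half of `2 ^
a`. So `y` is at most the midpoint of `i` and `j`, `i'` is at least it, and `x > i'`. -/
theorem powMatrix_lt {n : ℕ} {i i' j x y : Fin n} (hi : i < i') (hyj : y < j)
    (h1 : powMatrix n i j = true) (h2 : powMatrix n i' j = true) (h3 : powMatrix n i y = true)
    (h4 : powMatrix n i' x = true) : y < x := by
  rw [powMatrix_eq_true] at h1 h2 h3 h4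
  obtain ⟨a, ha⟩ := h1
  obtain ⟨b, hb⟩ := h2
  obtain ⟨c, hc⟩ := h3
  obtain ⟨d, hd⟩ := h4
  have hdbl : ∀ e, 2 ^ e < 2 ^ a → 2 * 2 ^ e ≤ 2 ^ a := by
    intro e he
    rw [← pow_succ']
    exact Nat.pow_le_pow_right two_pos ((Nat.pow_lt_pow_iff_right one_lt_two).1 he)
  rw [Fin.lt_def] at *
  have hb2 := hdbl b (by omega)
  have hc2 := hdbl c (by omega)
  have hd0 : 0 < 2 ^ d := by positivity
  omega

theorem not_contains_fullPattern_powMatrix (n : ℕ) : ¬ Contains (powMatrix n) fullPattern := by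
  rintro ⟨f, g, hf, hg, h⟩
  exact lt_irrefl _ (powMatrix_lt (hf (by decide : (0 : Fin 2) < 1))
    (hg (by decide : (0 : Fin 2) < 1)) (h 0 1 rfl) (h 1 1 rfl) (h 0 0 rfl) (h 1 0 rfl))

theorem not_contains_logPattern_powMatrix (n : ℕ) : ¬ Contains (powMatrix n) logPattern := by
  rintro ⟨f, g, hf, hg, h⟩
  exact lt_asymm (hg (by decide : (0 : Fin 3) < 1)) (powMatrix_lt (hf (by decide : (0 : Fin 2) < 1))
    (hg (by decide : (1 : Fin 3) < 2)) (h 0 2 rfl) (h 1 2 rfl) (h 0 1 rfl) (h 1 0 rfl))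

theorem le_ones_powMatrix (t : ℕ) : 2 ^ t * (t + 1) ≤ ones (powMatrix (2 ^ (t + 1))) := by
  have h2 : 2 ^ (t + 1) = 2 ^ t + 2 ^ t := by ring
  have hle : ∀ a : Fin (t + 1), 2 ^ (a : ℕ) ≤ 2 ^ t := fun a =>
    Nat.pow_le_pow_right two_pos (by omega)
  let φ : Fin (2 ^ t) × Fin (t + 1) → Fin (2 ^ (t + 1)) × Fin (2 ^ (t + 1)) := fun p =>
    (⟨p.1, by have := p.1.2; omega⟩, ⟨p.1 + 2 ^ (p.2 : ℕ), by have := p.1.2; have := hle p.2; omega⟩)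
  have := Finset.card_le_card_of_injOn (s := (Finset.univ : Finset (Fin (2 ^ t) × Fin (t + 1))))
    (t := Finset.univ.filter fun p : Fin (2 ^ (t + 1)) × Fin (2 ^ (t + 1)) =>
      powMatrix (2 ^ (t + 1)) p.1 p.2 = true) φ ?_ ?_
  · simpa [ones] using this
  · intro p _
    simp only [Finset.coe_filter, Finset.mem_univ, true_and, Set.mem_ofPred_eq, powMatrix_eq_true]
    exact ⟨p.2, rfl⟩
  · intro p _ p' _ h
    simp only [φ, Prod.mk.injEq, Fin.mk.injEq] at h
    have h1 : 2 ^ (p.2 : ℕ) = 2 ^ (p'.2 : ℕ) := by omega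
    exact Prod.ext (Fin.ext h.1) (Fin.ext (Nat.pow_right_injective le_rfl h1))

theorem not_linear_of_powMatrix {a b : ℕ} {P : Mat a b}
    (h : ∀ n, ¬ Contains (powMatrix n) P) : ¬ Linear P := by
  refine not_linear_of_forall_exists fun C => ⟨2 ^ (2 * C + 1), powMatrix _, h _, ?_⟩
  refine lt_of_lt_of_le ?_ (le_ones_powMatrix (2 * C))
  have : 0 < 2 ^ (2 * C) := by positivity
  rw [pow_succ]
  nlinarith

theorem not_linear_fullPattern : ¬ Linear fullPattern :=
  not_linear_of_powMatrix not_contains_fullPattern_powMatrix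

theorem not_linear_logPattern : ¬ Linear logPattern :=
  not_linear_of_powMatrix not_contains_logPattern_powMatrix

/-! ### Non-linearity of the alternating pattern -/

/-- A 0-1 matrix with rows indexed by `G × Fin n` and with special columns indexed by `G`. The
first one of the row `(g, i)` is in the special column `g`, and every row has at least `d` ones. The
matrix avoids the alternating pattern. Moreover, to the right of the special column `g`, no one of
the row `(g, i)` is followed by a later one of a lower row `(g, i')`. -/
structure Layered (d D : ℕ) (G : Type) [LinearOrder G] [Fintype G] (n : ℕ) where
  /-- The ordered type of positions of rows. -/
  R : Type
  /-- The ordered type of columns. -/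
  C : Type
  [linearOrderR : LinearOrder R]
  [linearOrderC : LinearOrder C]
  /-- The position of a row. -/
  row : G × Fin n → R
  /-- The special columns. -/
  sp : G → C
  /-- The other columns. -/
  N : Finset C
  /-- The set of ones. -/
  M : G × Fin n → C → Prop
  row_injective : Function.Injective row
  row_lt : ∀ {g i i'}, i < i' → row (g, i) < row (g, i')
  sp_strictMono : StrictMono sp
  mem_or : ∀ {p c}, M p c → (∃ g, sp g = c) ∨ c ∈ N
  M_sp : ∀ g i, M (g, i) (sp g)
  sp_le : ∀ {g i c}, M (g, i) c → sp g ≤ c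
  eq_of_M_sp : ∀ {g i g'}, M (g, i) (sp g') → g' = g
  exists_card : ∀ p, ∃ A : Finset C, A.card = d ∧ ∀ c ∈ A, M p c
  avoid : ∀ {p q c₁ c₂ c₃ c₄}, row p < row q → c₁ < c₂ → c₂ < c₃ → c₃ < c₄ →
    M p c₁ → M q c₂ → M p c₃ → M q c₄ → False
  avoid_special : ∀ {g i i' c₃ c₄}, i < i' → sp g < c₃ → c₃ < c₄ →
    M (g, i) c₃ → M (g, i') c₄ → False
  -- For `D = d` there are at most as many other columns as rows, while the ones per row are
  -- unbounded as `d` grows.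
  card_N_le : D * N.card ≤ d * (Fintype.card G * n)

namespace Layered

attribute [instance] linearOrderR linearOrderC

/-- A single special column full of ones. -/
def single (D n : ℕ) : Layered 1 D Unit n where
  R := Fin n
  C := Unit
  row := Prod.snd
  sp := id
  N := ∅
  M := fun _ _ => True
  row_injective := fun p q h => Prod.ext rfl h
  row_lt := fun h => h
  sp_strictMono := strictMono_id
  mem_or := fun {_ c} _ => Or.inl ⟨c, rfl⟩
  M_sp := fun _ _ => trivial
  sp_le := fun _ => le_rfl
  eq_of_M_sp := fun _ => rfl
  exists_card := fun _ => ⟨{()}, rfl, fun _ _ => trivial⟩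
  avoid := fun _ h => (lt_irrefl _ h).elim
  avoid_special := fun _ h => (lt_irrefl _ h).elim
  card_N_le := by simp

/-- No rows and `D` special columns. -/
def empty (d D : ℕ) : Layered d D (Fin D) 0 where
  R := Unit
  C := Fin D
  row := fun _ => ()
  sp := id
  N := ∅
  M := fun _ _ => True
  row_injective := fun p => p.2.elim0
  row_lt := fun {_ i} => i.elim0
  sp_strictMono := strictMono_id
  mem_or := fun {_ c} _ => Or.inl ⟨c, rfl⟩
  M_sp := fun _ i => i.elim0
  sp_le := fun {_ i} => i.elim0
  eq_of_M_sp := fun {_ i} => i.elim0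
  exists_card := fun p => p.2.elim0
  avoid := fun {p} => p.2.elim0
  avoid_special := fun {_ i} => i.elim0
  card_N_le := by simp

/-! ### Composition of layered matrices -/

section Comp

variable {d D n f : ℕ} {G H : Type} [LinearOrder G] [Fintype G] [LinearOrder H] [Fintype H]
  (T : Layered d D G f) (B : Layered (d + 1) D H n) (e : H ≃ Fin f)

/-- The ones of the composition in a row that comes from the outer matrix. -/
def OuterOne (g : G) (h : H) (c : T.C ×ₗ WithTop B.C) : Prop :=
  (∃ x, c = toLex (x, ⊤) ∧ T.M (g, e h) x) ∨ c = toLex (T.sp g, (B.sp h : WithTop B.C))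

/-- The ones of the composition in a row that comes from a copy of the inner matrix. -/
def InnerOne (g : G) (h : H) (i : Fin n) (c : T.C ×ₗ WithTop B.C) : Prop :=
  ∃ y : B.C, c = toLex (T.sp g, (y : WithTop B.C)) ∧ B.M (h, i) y

variable {T B e}

theorem OuterOne.fst {g : G} {h : H} {c : T.C ×ₗ WithTop B.C} (hc : OuterOne T B e g h c) :
    T.M (g, e h) (ofLex c).1 := by
  rcases hc with ⟨x, rfl, hx⟩ | rfl
  · exact hx
  · exact T.M_sp _ _

theorem OuterOne.sp_le {g : G} {h : H} {c : T.C ×ₗ WithTop B.C} (hc : OuterOne T B e g h c) :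
    toLex (T.sp g, (B.sp h : WithTop B.C)) ≤ c := by
  rcases hc with ⟨x, rfl, hx⟩ | rfl
  · rw [Prod.Lex.toLex_le_toLex]
    rcases (T.sp_le hx).lt_or_eq with h | h
    · exact Or.inl h
    · exact Or.inr ⟨h, le_top⟩
  · exact le_rfl

theorem OuterOne.exists_of_lt {g : G} {h : H} {c : T.C ×ₗ WithTop B.C}
    (hc : OuterOne T B e g h c) (hlt : toLex (T.sp g, (B.sp h : WithTop B.C)) < c) :
    ∃ x, c = toLex (x, ⊤) ∧ T.M (g, e h) x ∧ T.sp g ≤ x := by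
  rcases hc with ⟨x, rfl, hx⟩ | rfl
  · exact ⟨x, rfl, hx, T.sp_le hx⟩
  · exact (lt_irrefl _ hlt).elim

theorem toLex_top_lt {α β : Type*} [LinearOrder α] [LinearOrder β] {x x' : α} {y : WithTop β} :
    toLex (x, (⊤ : WithTop β)) < toLex (x', y) ↔ x < x' := by
  simp [Prod.Lex.toLex_lt_toLex]

/-- Two ones in the same block would put a one of `g'` into the special column of `g` in `T`, so
avoidance can be checked in `T`. -/
theorem OuterOne.fst_lt {g g' : G} {h h' : H} {c c' : T.C ×ₗ WithTop B.C} (hg : g ≠ g')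
    (hc : OuterOne T B e g h c) (hc' : OuterOne T B e g' h' c') (hlt : c < c') :
    (ofLex c).1 < (ofLex c').1 := by
  have h1 := hc.fst
  have h2 := hc'.fst
  rcases Prod.Lex.lt_iff.1 hlt with h3 | ⟨h3, h4⟩
  · exact h3
  · exfalso
    rcases hc with ⟨x, rfl, hx⟩ | rfl
    · exact not_top_lt h4
    · rw [← h3] at h2
      exact hg (T.eq_of_M_sp h2)

/-- For rows of one special column, `e` reverses the order, so the new one of the lower row is to
the left of that of the upper row. In an alternation the last three ones are then old ones, and the
last two contradict `avoid_special`. -/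
theorem outer_outer {g g' : G} {h h' : H} {c₁ c₂ c₃ c₄ : T.C ×ₗ WithTop B.C}
    (he : ∀ h h', h < h' → e h' < e h)
    (hr : T.row (g, e h) < T.row (g', e h')) (h12 : c₁ < c₂) (h23 : c₂ < c₃) (h34 : c₃ < c₄)
    (h1 : OuterOne T B e g h c₁) (h2 : OuterOne T B e g' h' c₂) (h3 : OuterOne T B e g h c₃)
    (h4 : OuterOne T B e g' h' c₄) : False := by
  by_cases hg : g = g'
  · subst hg
    have hee : e h < e h' := by
      rcases lt_trichotomy (e h) (e h') with h0 | h0 | h0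
      · exact h0
      · rw [h0] at hr
        exact (lt_irrefl _ hr).elim
      · exact (lt_asymm hr (T.row_lt h0)).elim
    have hh : h' < h := by
      rcases lt_trichotomy h h' with h0 | h0 | h0
      · exact (lt_asymm hee (he _ _ h0)).elim
      · rw [h0] at hee
        exact (lt_irrefl _ hee).elim
      · exact h0
    have hlt : toLex (T.sp g, (B.sp h' : WithTop B.C)) < toLex (T.sp g, (B.sp h : WithTop B.C)) :=
      Prod.Lex.toLex_lt_toLex.2 (Or.inr ⟨rfl, WithTop.coe_lt_coe.2 (B.sp_strictMono hh)⟩)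
    obtain ⟨x₂, rfl, -, hx₂⟩ := h2.exists_of_lt (hlt.trans (h1.sp_le.trans_lt h12))
    obtain ⟨x₃, rfl, hM₃, -⟩ := h3.exists_of_lt ((h1.sp_le.trans_lt h12).trans h23)
    obtain ⟨x₄, rfl, hM₄, -⟩ :=
      h4.exists_of_lt (hlt.trans (((h1.sp_le.trans_lt h12).trans h23).trans h34))
    rw [toLex_top_lt] at h23 h34
    exact T.avoid_special hee (hx₂.trans_lt h23) h34 hM₃ hM₄
  · exact T.avoid hr (h1.fst_lt hg h2 h12) (h2.fst_lt (Ne.symm hg) h3 h23) (h3.fst_lt hg h4 h34)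
      h1.fst h2.fst h3.fst h4.fst

theorem fst_eq_of_between {α β : Type*} [LinearOrder α] [LinearOrder β] {x : α} {y y' : β}
    {c : α ×ₗ β} (h : toLex (x, y) < c) (h' : c < toLex (x, y')) :
    ∃ z, c = toLex (x, z) ∧ y < z ∧ z < y' := by
  induction c with
  | _ c =>
    obtain ⟨a, b⟩ := c
    rw [Prod.Lex.toLex_lt_toLex] at h h'
    dsimp only at h h'
    rcases h with h | ⟨rfl, h⟩
    · rcases h' with h' | ⟨rfl, h'⟩
      · exact (lt_asymm h h').elim
      · exact (lt_irrefl _ h).elim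
    · rcases h' with h' | ⟨-, h'⟩
      · exact (lt_irrefl _ h').elim
      · exact ⟨b, rfl, h, h'⟩

/-- The third one is an old one of the outer row, yet lies between two columns of one copy of `B`;
old columns come after the copy in their block. -/
theorem outer_inner {g g' : G} {h h' : H} {i : Fin n} {c₁ c₂ c₃ c₄ : T.C ×ₗ WithTop B.C}
    (h12 : c₁ < c₂) (h23 : c₂ < c₃) (h34 : c₃ < c₄)
    (h1 : OuterOne T B e g h c₁) (h2 : InnerOne T B g' h' i c₂) (h3 : OuterOne T B e g h c₃)
    (h4 : InnerOne T B g' h' i c₄) : False := by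
  obtain ⟨y₂, rfl, -⟩ := h2
  obtain ⟨y₄, rfl, -⟩ := h4
  obtain ⟨x, rfl, -⟩ := h3.exists_of_lt (h1.sp_le.trans_lt (h12.trans h23))
  obtain ⟨z, hz, -, hz'⟩ := fst_eq_of_between h23 h34
  rw [toLex_inj, Prod.mk.injEq] at hz
  rw [← hz.2] at hz'
  exact not_top_lt hz'

/-- The second one lies between two ones in a single copy, so both rows belong to that copy. -/
theorem inner_inner {g g' : G} {h h' : H} {i i' : Fin n} {c₁ c₂ c₃ c₄ : T.C ×ₗ WithTop B.C}
    (hr : g = g' → B.row (h, i) < B.row (h', i')) (h12 : c₁ < c₂) (h23 : c₂ < c₃) (h34 : c₃ < c₄)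
    (h1 : InnerOne T B g h i c₁) (h2 : InnerOne T B g' h' i' c₂) (h3 : InnerOne T B g h i c₃)
    (h4 : InnerOne T B g' h' i' c₄) : False := by
  obtain ⟨y₁, rfl, hy₁⟩ := h1
  obtain ⟨y₂, rfl, hy₂⟩ := h2
  obtain ⟨y₃, rfl, hy₃⟩ := h3
  obtain ⟨y₄, rfl, hy₄⟩ := h4
  obtain ⟨z, hz, hz1, hz2⟩ := fst_eq_of_between h12 h23
  rw [toLex_inj, Prod.mk.injEq] at hz
  obtain ⟨hg, rfl⟩ := hz
  obtain rfl := T.sp_strictMono.injective hg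
  rw [Prod.Lex.toLex_lt_toLex] at h34
  simp only [lt_self_iff_false, true_and, false_or] at h34
  exact B.avoid (hr rfl) (WithTop.coe_lt_coe.1 hz1) (WithTop.coe_lt_coe.1 hz2)
    (WithTop.coe_lt_coe.1 h34) hy₁ hy₂ hy₃ hy₄

variable (T B e)

/-- Replace every special column of `T` by a copy of `B` followed by that column; the rows of the
special column get one new one each, in the special columns of the copy. -/
noncomputable def comp (he : ∀ h h', h < h' → e h' < e h) (hD : D ≤ f) :
    Layered (d + 1) D (G ×ₗ H) (n + 1) where
  -- Rows of `T` lie above all rows of the copies, so an inner row above an outer one never has to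
  -- be considered. Column `(x, ⊤)` is the old column `x`; if `x` is not special, it is the only
  -- used column of its block.
  R := T.R ⊕ₗ (G ×ₗ B.R)
  C := T.C ×ₗ WithTop B.C
  row := fun p => Fin.cases
    (toLex (Sum.inl (T.row ((ofLex p.1).1, e (ofLex p.1).2))))
    (fun i => toLex (Sum.inr (toLex ((ofLex p.1).1, B.row ((ofLex p.1).2, i))))) p.2
  sp := fun g => toLex (T.sp (ofLex g).1, (B.sp (ofLex g).2 : WithTop B.C))
  N := (T.N ∪ Finset.univ.image T.sp).image (fun x => toLex (x, ⊤)) ∪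
    ((Finset.univ : Finset G) ×ˢ B.N).image fun q => toLex (T.sp q.1, (q.2 : WithTop B.C))
  M := fun p c => Fin.cases (OuterOne T B e (ofLex p.1).1 (ofLex p.1).2 c)
    (fun i => InnerOne T B (ofLex p.1).1 (ofLex p.1).2 i c) p.2
  row_injective := by
    rintro ⟨g, i⟩ ⟨g', i'⟩ h
    refine Fin.cases (fun h => ?_) (fun i h => ?_) i h <;>
    refine Fin.cases (fun h => ?_) (fun i' h => ?_) i' h
    · simp only [Fin.cases_zero, EmbeddingLike.apply_eq_iff_eq, Sum.inl.injEq,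
        T.row_injective.eq_iff, Prod.mk.injEq] at h
      simp only [Prod.mk.injEq, and_true]
      exact ofLex.injective (Prod.ext h.1 h.2)
    · simp at h
    · simp at h
    · simp only [Fin.cases_succ, EmbeddingLike.apply_eq_iff_eq, Sum.inr.injEq,
        B.row_injective.eq_iff, Prod.mk.injEq] at h
      simp only [Prod.mk.injEq, h.2.2, and_true]
      exact ofLex.injective (Prod.ext h.1 h.2.1)
  row_lt := by
    intro g i i' h
    induction i' using Fin.cases with
    | zero => simp at h
    | succ i' =>
      induction i using Fin.cases with
      | zero => simp
      | succ i =>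
        simp only [Fin.cases_succ, Sum.Lex.inr_lt_inr_iff, Prod.Lex.toLex_lt_toLex]
        exact Or.inr ⟨trivial, B.row_lt (Fin.succ_lt_succ_iff.1 h)⟩
  sp_strictMono := by
    intro g g' h
    rw [Prod.Lex.lt_iff] at h
    rw [Prod.Lex.toLex_lt_toLex]
    rcases h with h | ⟨h, h'⟩
    · exact Or.inl (T.sp_strictMono h)
    · exact Or.inr ⟨congrArg T.sp h, WithTop.coe_lt_coe.2 (B.sp_strictMono h')⟩
  mem_or := by
    rintro ⟨g, i⟩ c h
    induction i using Fin.cases with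
    | zero =>
      rcases h with ⟨x, rfl, hx⟩ | rfl
      · refine Or.inr (Finset.mem_union_left _ (Finset.mem_image_of_mem _ ?_))
        rcases T.mem_or hx with ⟨g, rfl⟩ | hx
        · exact Finset.mem_union_right _ (Finset.mem_image_of_mem _ (Finset.mem_univ _))
        · exact Finset.mem_union_left _ hx
      · exact Or.inl ⟨g, rfl⟩
    | succ i =>
      obtain ⟨y, rfl, hy⟩ := h
      rcases B.mem_or hy with ⟨h, rfl⟩ | hy
      · exact Or.inl ⟨toLex ((ofLex g).1, h), rfl⟩
      · refine Or.inr (Finset.mem_union_right _ (Finset.mem_image.2 ⟨((ofLex g).1, y), ?_, rfl⟩))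
        exact Finset.mem_product.2 ⟨Finset.mem_univ _, hy⟩
  M_sp := by
    intro g i
    induction i using Fin.cases with
    | zero => exact Or.inr rfl
    | succ i => exact ⟨_, rfl, B.M_sp _ _⟩
  sp_le := by
    intro g i c h
    induction i using Fin.cases with
    | zero => exact OuterOne.sp_le h
    | succ i =>
      obtain ⟨y, rfl, hy⟩ := h
      exact Prod.Lex.toLex_le_toLex.2 (Or.inr ⟨rfl, WithTop.coe_le_coe.2 (B.sp_le hy)⟩)
  eq_of_M_sp := by
    intro g i g' h
    induction i using Fin.cases with
    | zero =>
      rcases h with ⟨x, hx, -⟩ | h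
      · simp at hx
      · rw [toLex_inj, Prod.mk.injEq, WithTop.coe_inj] at h
        exact ofLex.injective
          (Prod.ext (T.sp_strictMono.injective h.1) (B.sp_strictMono.injective h.2))
    | succ i =>
      obtain ⟨y, hy, hM⟩ := h
      rw [toLex_inj, Prod.mk.injEq, WithTop.coe_inj] at hy
      rw [← hy.2] at hM
      exact ofLex.injective (Prod.ext (T.sp_strictMono.injective hy.1) (B.eq_of_M_sp hM))
  exists_card := by
    rintro ⟨g, i⟩
    induction i using Fin.cases with
    | zero =>
      obtain ⟨A, hA, hAM⟩ := T.exists_card ((ofLex g).1, e (ofLex g).2)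
      refine ⟨insert (toLex (T.sp (ofLex g).1, (B.sp (ofLex g).2 : WithTop B.C)))
        (A.image fun x => toLex (x, ⊤)), ?_, ?_⟩
      · rw [Finset.card_insert_of_notMem, Finset.card_image_of_injective, hA]
        · intro x y hxy
          simpa [toLex_inj] using hxy
        · simp
      · intro c hc
        rw [Finset.mem_insert, Finset.mem_image] at hc
        rcases hc with rfl | ⟨x, hx, rfl⟩
        · exact Or.inr rfl
        · exact Or.inl ⟨x, rfl, hAM x hx⟩
    | succ i =>
      obtain ⟨A, hA, hAM⟩ := B.exists_card ((ofLex g).2, i)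
      refine ⟨A.image fun y : B.C => toLex (T.sp (ofLex g).1, (y : WithTop B.C)), ?_, ?_⟩
      · rw [Finset.card_image_of_injective, hA]
        intro x y hxy
        simpa [toLex_inj] using hxy
      · intro c hc
        obtain ⟨y, hy, rfl⟩ := Finset.mem_image.1 hc
        exact ⟨y, rfl, hAM y hy⟩
  avoid := by
    rintro ⟨g, i⟩ ⟨g', i'⟩ c₁ c₂ c₃ c₄ hr h12 h23 h34 h1 h2 h3 h4
    induction i using Fin.cases with
    | zero =>
      induction i' using Fin.cases with
      | zero =>
        simp only [Fin.cases_zero, Sum.Lex.inl_lt_inl_iff] at hr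
        exact outer_outer he hr h12 h23 h34 h1 h2 h3 h4
      | succ i' => exact outer_inner h12 h23 h34 h1 h2 h3 h4
    | succ i =>
      induction i' using Fin.cases with
      | zero => exact Sum.Lex.not_inr_lt_inl hr
      | succ i' =>
        simp only [Fin.cases_succ, Sum.Lex.inr_lt_inr_iff, Prod.Lex.toLex_lt_toLex] at hr
        refine inner_inner (fun hg => ?_) h12 h23 h34 h1 h2 h3 h4
        rcases hr with hr | hr
        · exact (hr.ne hg).elim
        · exact hr.2
  avoid_special := by
    intro g i i' c₃ c₄ hi hsp h34 h3 h4
    induction i' using Fin.cases with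
    | zero => simp at hi
    | succ i' =>
      obtain ⟨y₄, rfl, hy₄⟩ := h4
      obtain ⟨z, rfl, hz, hz'⟩ := fst_eq_of_between hsp h34
      induction i using Fin.cases with
      | zero =>
        obtain ⟨x, hx, -⟩ := OuterOne.exists_of_lt h3 hsp
        rw [toLex_inj, Prod.mk.injEq] at hx
        rw [hx.2] at hz'
        exact not_top_lt hz'
      | succ i =>
        obtain ⟨y₃, hy, hy₃⟩ := h3
        rw [toLex_inj, Prod.mk.injEq] at hy
        obtain ⟨-, rfl⟩ := hy
        exact B.avoid_special (Fin.succ_lt_succ_iff.1 hi) (WithTop.coe_lt_coe.1 hz)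
          (WithTop.coe_lt_coe.1 hz') hy₃ hy₄
  card_N_le := by
    have hH : Fintype.card H = f := by simpa using Fintype.card_congr e
    have hT := T.card_N_le
    have hB := B.card_N_le
    rw [hH] at hB
    have hcard : Fintype.card (G ×ₗ H) = Fintype.card G * f := by
      rw [← hH, ← Fintype.card_prod]
      exact Fintype.card_congr ofLex
    rw [hcard]
    refine (Nat.mul_le_mul_left D ((Finset.card_union_le _ _).trans (Nat.add_le_add
      (Finset.card_image_le.trans ((Finset.card_union_le _ _).trans
        (Nat.add_le_add_left Finset.card_image_le _))) Finset.card_image_le))).trans ?_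
    rw [Finset.card_product, Finset.card_univ]
    -- The old special columns of `T` are no longer special; the hypothesis `D ≤ f` pays for these
    -- `Fintype.card G` extra columns.
    calc D * (T.N.card + Fintype.card G + Fintype.card G * B.N.card)
        = D * T.N.card + Fintype.card G * D + Fintype.card G * (D * B.N.card) := by ring
      _ ≤ d * (Fintype.card G * f) + Fintype.card G * f +
          Fintype.card G * ((d + 1) * (f * n)) := by gcongr
      _ = (d + 1) * (Fintype.card G * f * (n + 1)) := by ring

end Comp

/-- Double induction of Ackermann type: the outer matrix has one one fewer per row, but as many rows
per special column as the inner matrix has special columns. -/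
theorem exists_layered {D : ℕ} (hD : 0 < D) (d n : ℕ) :
    ∃ (G : Type) (_ : LinearOrder G) (_ : Fintype G), Nonempty G ∧
      Nonempty (Layered (d + 1) D G n) := by
  induction d generalizing n with
  | zero => exact ⟨Unit, inferInstance, inferInstance, ⟨()⟩, ⟨single D n⟩⟩
  | succ d ih =>
    -- The bound `D ≤ Fintype.card G` is carried through the inner induction because `comp` requires
    -- it.
    suffices h : ∃ (G : Type) (_ : LinearOrder G) (_ : Fintype G), D ≤ Fintype.card G ∧
        Nonempty (Layered (d + 1 + 1) D G n) by
      obtain ⟨G, i1, i2, h1, h2⟩ := h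
      exact ⟨G, i1, i2, Fintype.card_pos_iff.1 (hD.trans_le h1), h2⟩
    induction n with
    | zero => exact ⟨Fin D, inferInstance, inferInstance, by simp, ⟨empty _ D⟩⟩
    | succ n ihn =>
      obtain ⟨H, i1, i2, h1, ⟨B⟩⟩ := ihn
      obtain ⟨G, i3, i4, h3, ⟨T⟩⟩ := ih (Fintype.card H)
      let e₀ : H ≃o Fin (Fintype.card H) := (Fintype.orderIsoFinOfCardEq H rfl).symm
      refine ⟨G ×ₗ H, inferInstance, inferInstance, ?_,
        ⟨T.comp B (e₀.toEquiv.trans Fin.revPerm) (fun h h' hlt => ?_) h1⟩⟩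
      · have : Fintype.card (G ×ₗ H) = Fintype.card G * Fintype.card H := by
          rw [← Fintype.card_prod]
          exact Fintype.card_congr ofLex
        rw [this]
        exact h1.trans (Nat.le_mul_of_pos_left _ Fintype.card_pos)
      · exact Fin.rev_lt_rev.2 (e₀.strictMono hlt)

end Layered

/-- The rank of an element with respect to a finite set. -/
def rank {α : Type*} [LinearOrder α] (A : Finset α) (x : α) : ℕ := (A.filter (· < x)).card

theorem rank_mono {α : Type*} [LinearOrder α] (A : Finset α) : Monotone (rank A) := fun _ _ h =>
  Finset.card_le_card (Finset.monotone_filter_right A fun _ _ h' => lt_of_lt_of_le h' h)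

theorem rank_lt_rank {α : Type*} [LinearOrder α] {A : Finset α} {x y : α} (hx : x ∈ A)
    (h : x < y) : rank A x < rank A y := by
  refine Finset.card_lt_card (Finset.ssubset_iff_of_subset
    (Finset.monotone_filter_right A fun _ _ h' => lt_trans h' h) |>.2 ⟨x, ?_, ?_⟩)
  · simp [hx, h]
  · simp

theorem rank_injOn {α : Type*} [LinearOrder α] (A : Finset α) : Set.InjOn (rank A) A := by
  intro x hx y hy h
  rcases lt_trichotomy x y with h' | h' | h'
  · exact ((rank_lt_rank hx h').ne h).elim
  · exact h'
  · exact ((rank_lt_rank hy h').ne' h).elim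

theorem rank_lt_card {α : Type*} [LinearOrder α] {A : Finset α} {x : α} (hx : x ∈ A) :
    rank A x < A.card :=
  Finset.card_lt_card (Finset.filter_ssubset.2 ⟨x, hx, lt_irrefl x⟩)

/-- A finite set of ones in linearly ordered rows and columns that avoids the alternating pattern
gives a square matrix that avoids it. -/
theorem exists_mat_of_avoid {R C : Type*} [LinearOrder R] [LinearOrder C] (A : Finset R)
    (B : Finset C) (X : Finset (R × C)) (hX : X ⊆ A ×ˢ B) {n : ℕ} (hA : A.card ≤ n)
    (hB : B.card ≤ n)
    (h : ∀ r s c₁ c₂ c₃ c₄, r < s → c₁ < c₂ → c₂ < c₃ → c₃ < c₄ → (r, c₁) ∈ X → (s, c₂) ∈ X →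
      (r, c₃) ∈ X → (s, c₄) ∈ X → False) :
    ∃ M : Mat n n, ¬ Contains M alternatingPattern ∧ X.card ≤ ones M := by
  let M : Mat n n := fun i j => decide (∃ r c, (r, c) ∈ X ∧ rank A r = i ∧ rank B c = j)
  have hM : ∀ i j, M i j = true ↔ ∃ r c, (r, c) ∈ X ∧ rank A r = i ∧ rank B c = j := by
    simp [M]
  have hXA : ∀ {r c}, (r, c) ∈ X → r ∈ A ∧ c ∈ B := fun hx => Finset.mem_product.1 (hX hx)
  refine ⟨M, ?_, ?_⟩
  · rintro ⟨f, g, hf, hg, hP⟩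
    obtain ⟨r₁, c₁, hx₁, hr₁, hc₁⟩ := (hM _ _).1 (hP 0 0 rfl)
    obtain ⟨r₂, c₂, hx₂, hr₂, hc₂⟩ := (hM _ _).1 (hP 1 1 rfl)
    obtain ⟨r₃, c₃, hx₃, hr₃, hc₃⟩ := (hM _ _).1 (hP 0 2 rfl)
    obtain ⟨r₄, c₄, hx₄, hr₄, hc₄⟩ := (hM _ _).1 (hP 1 3 rfl)
    obtain rfl := rank_injOn A (hXA hx₁).1 (hXA hx₃).1 (hr₁.trans hr₃.symm)
    obtain rfl := rank_injOn A (hXA hx₂).1 (hXA hx₄).1 (hr₂.trans hr₄.symm)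
    refine h r₁ r₂ c₁ c₂ c₃ c₄ ((rank_mono A).reflect_lt ?_) ((rank_mono B).reflect_lt ?_)
      ((rank_mono B).reflect_lt ?_) ((rank_mono B).reflect_lt ?_) hx₁ hx₂ hx₃ hx₄
    · rw [hr₁, hr₂]; exact hf (by decide)
    · rw [hc₁, hc₂]; exact hg (by decide)
    · rw [hc₂, hc₃]; exact hg (by decide)
    · rw [hc₃, hc₄]; exact hg (by decide)
  · have hlt : ∀ x : X, rank A x.1.1 < n ∧ rank B x.1.2 < n := fun x =>
      ⟨(rank_lt_card (hXA x.2).1).trans_le hA, (rank_lt_card (hXA x.2).2).trans_le hB⟩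
    have := Finset.card_le_card_of_injOn (s := (Finset.univ : Finset X))
      (t := Finset.univ.filter fun p : Fin n × Fin n => M p.1 p.2 = true)
      (fun x => (⟨_, (hlt x).1⟩, ⟨_, (hlt x).2⟩)) ?_ ?_
    · simpa [ones] using this
    · intro x _
      simp only [Finset.coe_filter, Finset.mem_univ, true_and, Set.mem_ofPred_eq, hM]
      exact ⟨_, _, x.2, rfl, rfl⟩
    · intro x _ y _ hxy
      simp only [Prod.mk.injEq, Fin.mk.injEq] at hxy
      exact Subtype.ext (Prod.ext (rank_injOn A (hXA x.2).1 (hXA y.2).1 hxy.1)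
        (rank_injOn B (hXA x.2).2 (hXA y.2).2 hxy.2))

theorem not_linear_alternatingPattern : ¬ Linear alternatingPattern := by
  refine not_linear_of_forall_exists fun C => ?_
  -- With `d = D = 2 * C + 1` and `n = 1` there are |G| rows, at most 2|G| columns and at least (2C
  -- + 1)|G| ones, more than C · 2|G|.
  obtain ⟨G, _, _, hG, ⟨L⟩⟩ := Layered.exists_layered (Nat.succ_pos (2 * C)) (2 * C) 1
  set B := Finset.univ.image L.sp ∪ L.N
  set X := ((Finset.univ : Finset (G × Fin 1)).biUnion fun p =>
    (B.filter (L.M p)).image fun c => (L.row p, c))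
  have hGp : 0 < Fintype.card G := Fintype.card_pos
  have hX : ∀ p c, (L.row p, c) ∈ X → L.M p c := by
    intro p c h
    simp only [X, Finset.mem_biUnion, Finset.mem_image, Finset.mem_filter, Prod.mk.injEq] at h
    obtain ⟨q, -, c', ⟨-, h1⟩, h2, rfl⟩ := h
    rwa [← L.row_injective h2]
  have hXrow : ∀ r c, (r, c) ∈ X → ∃ p, r = L.row p := by
    intro r c h
    simp only [X, Finset.mem_biUnion, Finset.mem_image, Finset.mem_filter, Prod.mk.injEq] at h
    obtain ⟨q, -, c', -, h2, -⟩ := h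
    exact ⟨q, h2.symm⟩
  have hXc : (2 * C + 1) * Fintype.card G ≤ X.card := by
    rw [Finset.card_biUnion]
    · have hp : ∀ p ∈ (Finset.univ : Finset (G × Fin 1)),
          2 * C + 1 ≤ ((B.filter (L.M p)).image fun c => (L.row p, c)).card := by
        intro p _
        obtain ⟨A, hA, hAM⟩ := L.exists_card p
        rw [Finset.card_image_of_injective _ fun _ _ h => (Prod.mk.inj h).2]
        refine hA.ge.trans (Finset.card_le_card fun c hc => Finset.mem_filter.2 ⟨?_, hAM c hc⟩)
        rcases L.mem_or (hAM c hc) with ⟨g, rfl⟩ | h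
        · exact Finset.mem_union_left _ (Finset.mem_image_of_mem _ (Finset.mem_univ _))
        · exact Finset.mem_union_right _ h
      have := Finset.card_nsmul_le_sum _ _ _ hp
      simpa [mul_comm] using this
    · intro p _ q _ hpq
      rw [Function.onFun, Finset.disjoint_left]
      rintro x hx hx'
      obtain ⟨c, -, rfl⟩ := Finset.mem_image.1 hx
      obtain ⟨c', -, h⟩ := Finset.mem_image.1 hx'
      exact hpq (L.row_injective (Prod.mk.inj h).1).symm
  have hB : B.card ≤ 2 * Fintype.card G := by
    have h1 : B.card ≤ Fintype.card G + L.N.card :=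
      (Finset.card_union_le _ _).trans (Nat.add_le_add_right Finset.card_image_le _)
    have h2 := Nat.le_of_mul_le_mul_left L.card_N_le (Nat.succ_pos (2 * C))
    omega
  obtain ⟨M, hM, hle⟩ := exists_mat_of_avoid (Finset.univ.image L.row) B X (n := 2 * Fintype.card G)
    (by
      intro x hx
      simp only [X, Finset.mem_biUnion, Finset.mem_image, Finset.mem_filter] at hx
      obtain ⟨p, -, c, ⟨hc, -⟩, rfl⟩ := hx
      exact Finset.mem_product.2 ⟨Finset.mem_image_of_mem _ (Finset.mem_univ _), hc⟩)
    (Finset.card_image_le.trans (by simp; omega)) hB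
    (by
      intro r s c₁ c₂ c₃ c₄ hrs h12 h23 h34 h1 h2 h3 h4
      obtain ⟨p, rfl⟩ := hXrow _ _ h1
      obtain ⟨q, rfl⟩ := hXrow _ _ h2
      exact L.avoid hrs h12 h23 h34 (hX _ _ h1) (hX _ _ h2) (hX _ _ h3) (hX _ _ h4))
  refine ⟨_, M, hM, lt_of_lt_of_le ?_ (hXc.trans hle)⟩
  nlinarith

/-! ### Column deletions that preserve superlinearity -/

theorem ones_le_sum_of_cover {m n q : ℕ} (M : Mat m n) (F : Fin q → Mat m n)
    (Z : Finset (Fin m × Fin n))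
    (h : ∀ i j, M i j = true → (i, j) ∈ Z ∨ ∃ p, F p i j = true) :
    ones M ≤ ∑ p, ones (F p) + Z.card := by
  have h1 : (Finset.univ.filter fun x : Fin m × Fin n => M x.1 x.2 = true) ⊆
      (Finset.univ.biUnion fun p =>
        Finset.univ.filter fun x : Fin m × Fin n => F p x.1 x.2 = true) ∪ Z := by
    rintro ⟨i, j⟩ hx
    rw [Finset.mem_filter] at hx
    simp only [Finset.mem_union, Finset.mem_biUnion, Finset.mem_univ, true_and,
      Finset.mem_filter]
    exact (h i j hx.2).symm
  exact (Finset.card_le_card h1).trans ((Finset.card_union_le _ _).trans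
    (Nat.add_le_add_right Finset.card_biUnion_le _))

/-- A strictly increasing sequence with large gaps extends along a strictly increasing map. -/
theorem exists_strictMono_extension {b b' n : ℕ} (hbn : b ≤ n) {e : Fin b' → Fin b}
    (he : StrictMono e) {g : Fin b' → Fin n}
    (hgap : ∀ i j, i < j → (g i : ℕ) + b ≤ g j) (hlow : ∀ j, b ≤ (g j : ℕ))
    (hhigh : ∀ j, (g j : ℕ) + b ≤ n) :
    ∃ g' : Fin b → Fin n, StrictMono g' ∧ ∀ j, g' (e j) = g j := by
  -- The extension is `x ↦ x + s x` with `s` a running maximum of the shifts `g j - e j`, which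
  -- increase by the gap condition; before the first `e j` the empty supremum is 0.
  let s : Fin b → ℕ := fun x => (Finset.univ.filter fun j => e j ≤ x).sup fun j => (g j : ℕ) - e j
  have hs : Monotone s := fun x y hxy =>
    Finset.sup_mono (Finset.monotone_filter_right _ fun _ _ h => le_trans h hxy)
  have hlt : ∀ x : Fin b, (x : ℕ) + s x < n := by
    intro x
    have hx := x.2
    have : s x ≤ n - b := Finset.sup_le fun j _ => by have := hhigh j; omega
    omega
  refine ⟨fun x => ⟨x + s x, hlt x⟩, fun x y hxy => ?_, fun j => Fin.ext ?_⟩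
  · have := hs hxy.le
    rw [Fin.lt_def] at hxy ⊢
    dsimp only
    omega
  · have h1 : s (e j) = g j - e j := by
      refine le_antisymm (Finset.sup_le fun i hi => ?_)
        (Finset.le_sup (f := fun j => (g j : ℕ) - e j) (by simp))
      rcases (he.le_iff_le.1 (Finset.mem_filter.1 hi).2).eq_or_lt with rfl | hij
      · exact le_rfl
      · have := hgap i j hij
        have := (e j).2
        omega
    have := hlow j
    have := (e j).2
    dsimp only
    omega

/-- Drop the border columns and split the rest by residue modulo `b`. In each part the gaps leave
room for the empty columns. -/
theorem linear_of_nonempty_columns {a b b' : ℕ} {P : Mat a b} (hb : 0 < b)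
    {e : Fin b' → Fin b} (he : StrictMono e) (hne : ∀ j, ∃ i, P i (e j) = true)
    (hrange : ∀ i c, P i c = true → ∃ j, e j = c) (h : Linear (P.submatrix id e)) : Linear P := by
  refine h.of_cover b (2 * b) b fun n hn M hM => ?_
  let F : Fin b → Mat n n := fun p i j =>
    decide (M i j = true ∧ (j : ℕ) % b = p ∧ b ≤ j ∧ (j : ℕ) + b ≤ n)
  have hF : ∀ p i j, F p i j = true ↔
      M i j = true ∧ (j : ℕ) % b = p ∧ b ≤ j ∧ (j : ℕ) + b ≤ n := by
    simp [F]
  refine ⟨F, ?_, ?_⟩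
  · rintro p ⟨f, g, hf, hg, hfg⟩
    have hcol : ∀ j, (g j : ℕ) % b = p ∧ b ≤ g j ∧ (g j : ℕ) + b ≤ n := by
      intro j
      obtain ⟨i, hi⟩ := hne j
      exact ((hF _ _ _).1 (hfg i j hi)).2
    obtain ⟨g', hg', hg'e⟩ := exists_strictMono_extension hn he (g := g) (fun i j hij => by
      have h1 : (g i : ℕ) ≡ g j [MOD b] := (hcol i).1.trans (hcol j).1.symm
      have h2 : (g i : ℕ) < g j := hg hij
      have h3 := Nat.le_of_dvd (by omega) ((Nat.modEq_iff_dvd' h2.le).1 h1)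
      omega) (fun j => (hcol j).2.1) (fun j => (hcol j).2.2)
    refine hM ⟨f, g', hf, hg', fun i c hic => ?_⟩
    obtain ⟨j, rfl⟩ := hrange i c hic
    rw [hg'e]
    exact ((hF _ _ _).1 (hfg i j hic)).1
  · refine (ones_le_sum_of_cover M F ((Finset.univ : Finset (Fin n)) ×ˢ
      Finset.univ.filter fun j : Fin n => ¬ (b ≤ (j : ℕ) ∧ (j : ℕ) + b ≤ n)) ?_).trans
      (Nat.add_le_add_left ?_ _)
    · intro i j hij
      by_cases hj : b ≤ (j : ℕ) ∧ (j : ℕ) + b ≤ n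
      · exact Or.inr ⟨⟨j % b, Nat.mod_lt _ hb⟩, (hF _ _ _).2 ⟨hij, rfl, hj⟩⟩
      · exact Or.inl (by simpa using hj)
    · have h1 : (Finset.univ.filter fun j : Fin n => (j : ℕ) < b).card ≤ b := by
        simpa using Finset.card_le_card_of_injOn (t := Finset.range b) (fun j : Fin n => (j : ℕ))
          (fun j hj => by simpa using hj) Fin.val_injective.injOn
      have h2 : (Finset.univ.filter fun j : Fin n => (j.rev : ℕ) < b).card ≤ b := by
        simpa using Finset.card_le_card_of_injOn (t := Finset.range b)
          (fun j : Fin n => (j.rev : ℕ)) (fun j hj => by simpa using hj)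
          (Fin.val_injective.comp Fin.rev_injective).injOn
      have h3 : (Finset.univ.filter fun j : Fin n => ¬ (b ≤ (j : ℕ) ∧ (j : ℕ) + b ≤ n)) ⊆
          (Finset.univ.filter fun j : Fin n => (j : ℕ) < b) ∪
            Finset.univ.filter fun j : Fin n => (j.rev : ℕ) < b := by
        intro j hj
        simp only [Finset.mem_union, Finset.mem_filter, Finset.mem_univ, true_and,
          Fin.val_rev] at hj ⊢
        omega
      have h4 := (Finset.card_le_card h3).trans (Finset.card_union_le _ _)
      rw [Finset.card_product, Finset.card_univ, Fintype.card_fin, mul_comm]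
      exact Nat.mul_le_mul_right _ (by omega)

theorem MinimallyNonlinear.exists_row {a b : ℕ} {P : Mat a b} (h : MinimallyNonlinear P)
    (c : Fin b) : ∃ r, P r c = true := by
  by_contra hc
  set A := Finset.univ.filter fun c => ∃ r, P r c = true
  have hcA : c ∉ A := by simpa [A] using hc
  let e := A.orderEmbOfFin rfl
  have hA : A.card < b := by
    have hne : A ≠ Finset.univ := fun h' => hcA (h'.symm ▸ Finset.mem_univ c)
    simpa using Finset.card_lt_card (Finset.ssubset_univ_iff.2 hne)
  refine h.1.not_linear (linear_of_nonempty_columns c.pos e.strictMono (fun j => ?_)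
    (fun i c hic => ?_) (h.2 _ _ _ ⟨contains_submatrix P strictMono_id e.strictMono, fun h' => ?_⟩))
  · exact (Finset.mem_filter.1 (A.orderEmbOfFin_mem rfl j)).2
  · have : c ∈ Set.range e := by
      rw [Finset.range_orderEmbOfFin]
      simpa [A] using ⟨i, hic⟩
    exact this
  · exact absurd h'.card_le.2 (not_le.2 hA)

theorem MinimallyNonlinear.exists_col {a b : ℕ} {P : Mat a b} (h : MinimallyNonlinear P)
    (r : Fin a) : ∃ c, P r c = true := h.transpose.exists_row r

theorem strictMono_insertNth {b n : ℕ} {g : Fin b → Fin n} (hg : StrictMono g) {p q : Fin b}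
    (hpq : (q : ℕ) = p + 1) {j : Fin n} (hpj : g p < j) (hjq : j < g q) :
    StrictMono (q.castSucc.insertNth j g : Fin (b + 1) → Fin n) := by
  intro x y hxy
  rcases q.castSucc.eq_self_or_eq_succAbove x with rfl | ⟨x, rfl⟩ <;>
  rcases q.castSucc.eq_self_or_eq_succAbove y with rfl | ⟨y, rfl⟩
  · exact (lt_irrefl _ hxy).elim
  · rw [Fin.insertNth_apply_same, Fin.insertNth_apply_succAbove]
    rw [Fin.lt_succAbove_iff_le_castSucc, Fin.castSucc_le_castSucc_iff] at hxy
    exact hjq.trans_le (hg.monotone hxy)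
  · rw [Fin.insertNth_apply_same, Fin.insertNth_apply_succAbove]
    rw [Fin.succAbove_lt_iff_castSucc_lt, Fin.castSucc_lt_castSucc_iff] at hxy
    refine (hg.monotone ?_).trans_lt hpj
    rw [Fin.lt_def] at hxy
    rw [Fin.le_def]
    omega
  · simp only [Fin.insertNth_apply_succAbove]
    exact hg ((Fin.strictMono_succAbove _).lt_iff_lt.1 hxy)

/-- Inserting a column whose single one is between two adjacent ones preserves linearity. -/
theorem linear_of_single_between {a b : ℕ} {P : Mat a (b + 1)} {r : Fin a} {p q : Fin b}
    (hpq : (q : ℕ) = p + 1) (hp : P r p.castSucc = true) (hq : P r q.succ = true)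
    (hsingle : ∀ i, P i q.castSucc = true → i = r)
    (h : Linear (P.submatrix id q.castSucc.succAbove)) : Linear P := by
  refine h.of_cover 2 0 0 fun n _ M hM => ?_
  -- The ones of each row are split by the parity of their rank in the row. Two ones of equal parity
  -- have a one of `M` strictly between them, whose column can serve as the inserted one.
  let k : Fin n → Fin n → ℕ := fun i j => (Finset.univ.filter fun x => x < j ∧ M i x = true).card
  let F : Fin 2 → Mat n n := fun z i j => decide (M i j = true ∧ k i j % 2 = z)
  have hF : ∀ z i j, F z i j = true ↔ M i j = true ∧ k i j % 2 = z := by simp [F]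
  refine ⟨F, ?_, ?_⟩
  · rintro z ⟨f, g, hf, hg, hfg⟩
    have hp' := (hF _ _ _).1 (hfg r p (by
      rw [Matrix.submatrix_apply, id, Fin.succAbove_of_castSucc_lt _ _
        (Fin.castSucc_lt_castSucc_iff.2 (by rw [Fin.lt_def]; omega))]
      exact hp))
    have hq' := (hF _ _ _).1 (hfg r q (by
      rw [Matrix.submatrix_apply, id, Fin.succAbove_castSucc_self]
      exact hq))
    have hlt : g p < g q := hg (by rw [Fin.lt_def]; omega)
    have hj : ∃ j, g p < j ∧ j < g q ∧ M (f r) j = true := by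
      by_contra hno
      have hk : (Finset.univ.filter fun x => x < g q ∧ M (f r) x = true) =
          insert (g p) (Finset.univ.filter fun x => x < g p ∧ M (f r) x = true) := by
        ext x
        simp only [Finset.mem_filter, Finset.mem_univ, true_and, Finset.mem_insert]
        constructor
        · rintro ⟨h1, h2⟩
          rcases lt_trichotomy x (g p) with h3 | h3 | h3
          · exact Or.inr ⟨h3, h2⟩
          · exact Or.inl h3
          · exact (hno ⟨x, h3, h1, h2⟩).elim
        · rintro (rfl | ⟨h1, h2⟩)
          · exact ⟨hlt, hp'.1⟩
          · exact ⟨h1.trans hlt, h2⟩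
      have hk' : k (f r) (g q) = k (f r) (g p) + 1 := by
        simp only [k]
        rw [hk, Finset.card_insert_of_notMem (by simp)]
      omega
    obtain ⟨j, hpj, hjq, hMj⟩ := hj
    refine hM ⟨f, q.castSucc.insertNth j g, hf, strictMono_insertNth hg hpq hpj hjq,
      fun i c hic => ?_⟩
    rcases q.castSucc.eq_self_or_eq_succAbove c with rfl | ⟨c, rfl⟩
    · rw [Fin.insertNth_apply_same, hsingle i hic]
      exact hMj
    · rw [Fin.insertNth_apply_succAbove]
      exact ((hF _ _ _).1 (hfg i c hic)).1
  · have := ones_le_sum_of_cover M F ∅ fun i j hij =>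
      Or.inr ⟨⟨k i j % 2, Nat.mod_lt _ two_pos⟩, (hF _ _ _).2 ⟨hij, rfl⟩⟩
    simpa using this

theorem MinimallyNonlinear.exists_ne_of_between {a b : ℕ} {P : Mat a b}
    (h : MinimallyNonlinear P) {r : Fin a} {c c' c'' : Fin b} (hc : (c' : ℕ) = c + 1)
    (hc' : (c'' : ℕ) = c' + 1) (h1 : P r c = true) (h3 : P r c'' = true) :
    ∃ i, i ≠ r ∧ P i c' = true := by
  by_contra hno
  obtain _ | b := b
  · exact c.elim0
  obtain ⟨p, rfl⟩ : ∃ p : Fin b, c = p.castSucc := ⟨⟨c, by omega⟩, rfl⟩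
  obtain ⟨q, rfl⟩ : ∃ q : Fin b, c' = q.castSucc := ⟨⟨c', by omega⟩, rfl⟩
  obtain rfl : c'' = q.succ := Fin.ext (by simpa using hc')
  refine h.1.not_linear (linear_of_single_between (r := r) (p := p) (q := q) (by simpa using hc)
    h1 h3 (fun i hi => ?_) (h.2 _ _ _
      ⟨contains_submatrix P strictMono_id (Fin.strictMono_succAbove _), fun h' => ?_⟩))
  · by_contra hne
    exact hno ⟨i, hne, hi⟩
  · have := h'.card_le.2
    omega

/-! ### Minimally non-linear matrices without two-row obstructions -/

/-- No column has two ones to the right of which there are further ones in the same rows, no column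
has two ones to the left of which there are further ones in the same rows, and no two rows
alternate. -/
structure Unobstructed {a b : ℕ} (P : Mat a b) : Prop where
  right : ∀ {r s c c' c''}, P r c = true → P s c = true → c < c' → c < c'' →
    P r c' = true → P s c'' = true → r = s
  left : ∀ {r s c c' c''}, P r c = true → P s c = true → c' < c → c'' < c →
    P r c' = true → P s c'' = true → r = s
  alternating : ∀ {r s x y z w}, x < y → y < z → z < w → P r x = true → P s y = true →
    P r z = true → P s w = true → r = s

/-- Further ones of the two rows in the same column give the full square; in different columns, a
reflection of `logPattern`. -/
theorem unobstructed_of_forall_not_contains {a b : ℕ} {P : Mat a b}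
    (hP : ∀ q, q ≤ 4 → ∀ Q : Mat 2 q, ¬ Linear Q → ¬ Contains P Q) : Unobstructed P := by
  have hJ := hP 2 (by norm_num) _ not_linear_fullPattern
  have hR := hP 3 (by norm_num) _ not_linear_logPattern
  have hRr := hP 3 (by norm_num) _ (mt (linear_revRows _).1 not_linear_logPattern)
  have hRc := hP 3 (by norm_num) _ (mt (linear_revCols _).1 not_linear_logPattern)
  have hRrc := hP 3 (by norm_num) _
    (mt (linear_revRows _).1 (mt (linear_revCols _).1 not_linear_logPattern))
  have hS := hP 4 (by norm_num) _ not_linear_alternatingPattern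
  have hSr := hP 4 (by norm_num) _ (mt (linear_revRows _).1 not_linear_alternatingPattern)
  have right : ∀ {r s c c' c''}, r < s → P r c = true → P s c = true → c < c' → c < c'' →
      P r c' = true → P s c'' = true → False := by
    intro r s c c' c'' hrs h1 h2 h3 h4 h5 h6
    rcases lt_trichotomy c' c'' with h | rfl | h
    · exact hRc (contains_logPattern_revCols hrs h3 h h1 h5 h2 h6)
    · exact hJ (contains_fullPattern hrs h3 h1 h5 h2 h6)
    · exact hRrc (contains_logPattern_revRows_revCols hrs h4 h h2 h6 h1 h5)
  have left : ∀ {r s c c' c''}, r < s → P r c = true → P s c = true → c' < c → c'' < c →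
      P r c' = true → P s c'' = true → False := by
    intro r s c c' c'' hrs h1 h2 h3 h4 h5 h6
    rcases lt_trichotomy c' c'' with h | rfl | h
    · exact hRr (contains_logPattern_revRows hrs h h4 h6 h2 h5 h1)
    · exact hJ (contains_fullPattern hrs h3 h5 h1 h6 h2)
    · exact hR (contains_logPattern hrs h h3 h5 h1 h6 h2)
  refine ⟨fun {r s} _ _ _ h1 h2 h3 h4 h5 h6 => ?_, fun {r s} _ _ _ h1 h2 h3 h4 h5 h6 => ?_,
    fun {r s} _ _ _ _ h1 h2 h3 h4 h5 h6 h7 => ?_⟩ <;>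
  rcases lt_trichotomy r s with h | h | h
  · exact (right h h1 h2 h3 h4 h5 h6).elim
  · exact h
  · exact (right h h2 h1 h4 h3 h6 h5).elim
  · exact (left h h1 h2 h3 h4 h5 h6).elim
  · exact h
  · exact (left h h2 h1 h4 h3 h6 h5).elim
  · exact (hS (contains_alternatingPattern h h1 h2 h3 h4 h5 h6 h7)).elim
  · exact h
  · exact (hSr (contains_alternatingPattern_revRows h h1 h2 h3 h4 h5 h6 h7)).elim

theorem MinimallyNonlinear.unobstructed_or {a b : ℕ} {P : Mat a b} (h : MinimallyNonlinear P) :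
    Unobstructed P ∨ a ≤ 2 ∧ b ≤ 4 ∧ 2 ≤ a := by
  by_cases hP : ∀ q, q ≤ 4 → ∀ Q : Mat 2 q, ¬ Linear Q → ¬ Contains P Q
  · exact Or.inl (unobstructed_of_forall_not_contains hP)
  · push Not at hP
    obtain ⟨q, hq, Q, hQ, hc⟩ := hP
    have h1 := h.not_linear_imp hQ hc
    exact Or.inr ⟨h1.1, h1.2.trans hq, hc.card_le.1⟩

/-- A minimally non-linear matrix with `a` rows has at most `4 a - 2` columns. -/
theorem MinimallyNonlinear.card_columns_le {a b : ℕ} {P : Mat a b} (h : MinimallyNonlinear P) :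
    b ≤ 4 * a - 2 := by
  rcases h.unobstructed_or with hU | hU
  swap
  · omega
  rcases Nat.eq_zero_or_pos b with rfl | hb
  · exact Nat.zero_le _
  have ha : 0 < a := (h.exists_row ⟨0, hb⟩).choose.pos
  -- The label of a column is a row whose only one is there, if such a row exists.
  have hl : ∀ c : Fin b, ∃ r, P r c = true ∧
      ((∃ s, P s c = true ∧ ∀ c', P s c' = true → c' = c) → ∀ c', P r c' = true → c' = c) := by
    intro c
    by_cases hs : ∃ s, P s c = true ∧ ∀ c', P s c' = true → c' = c
    · obtain ⟨s, hs, hs'⟩ := hs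
      exact ⟨s, hs, fun _ => hs'⟩
    · obtain ⟨r, hr⟩ := h.exists_row c
      exact ⟨r, hr, fun h' => (hs h').elim⟩
  choose l hlP hl using hl
  have key := length_le_of_no_alternation
    (fun x : ℕ => if hx : x < b then l ⟨x, hx⟩ else ⟨0, ha⟩) b ?_ ?_
  · rw [Fintype.card_fin] at key
    omega
  · intro x hx h1 h2
    simp only [hx, (by omega : x < b), (by omega : x + 1 < b), dite_true] at h1 h2
    have e1 := hlP ⟨x, by omega⟩
    have e2 := hlP ⟨x + 1, by omega⟩
    have e3 := hlP ⟨x + 2, hx⟩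
    rw [h1] at e1
    rw [← h2] at e3
    -- Three equal labels: the middle column has a one in another row `i`. The common row has ones
    -- on both sides, so `i` has no other one, and the middle label should have been a row with a
    -- single one.
    obtain ⟨i, hi, hiP⟩ := h.exists_ne_of_between (c := ⟨x, by omega⟩) (c' := ⟨x + 1, by omega⟩)
      (c'' := ⟨x + 2, hx⟩) rfl rfl e1 e3
    have honly : ∀ c', P i c' = true → c' = ⟨x + 1, by omega⟩ := by
      intro c' hc'
      rcases lt_trichotomy c' ⟨x + 1, by omega⟩ with h0 | h0 | h0
      · exact (hi (hU.left hiP e2 h0 (by simp [Fin.lt_def]) hc' e1)).elim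
      · exact h0
      · exact (hi (hU.right hiP e2 h0 (by simp [Fin.lt_def]) hc' e3)).elim
    have := hl ⟨x + 1, by omega⟩ ⟨i, hiP, honly⟩ _ e1
    simp at this
  · intro w x y z hwx hxy hyz hz h1 h2
    simp only [hz, (by omega : w < b), (by omega : x < b), (by omega : y < b), dite_true]
      at h1 h2 ⊢
    have e1 := hlP ⟨w, by omega⟩
    have e2 := hlP ⟨x, by omega⟩
    have e3 := hlP ⟨y, by omega⟩
    have e4 := hlP ⟨z, hz⟩
    rw [← h1] at e3
    rw [← h2] at e4
    exact hU.alternating (Fin.mk_lt_mk.2 hwx) (Fin.mk_lt_mk.2 hxy) (Fin.mk_lt_mk.2 hyz) e1 e2 e3 e4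

theorem MinimallyNonlinear.mem_Icc {k c : ℕ} (hk : 2 < k) {P : Mat k c}
    (h : MinimallyNonlinear P) : c ∈ Finset.Icc ⌈((k : ℚ) + 2) / 4⌉₊ (4 * k - 2) := by
  rw [Finset.mem_Icc]
  refine ⟨Nat.ceil_le.2 ?_, h.card_columns_le⟩
  have h1 := h.transpose.card_columns_le
  have h2 : ((k + 2 : ℕ) : ℚ) ≤ ((4 * c : ℕ) : ℚ) := Nat.cast_le.2 (by omega)
  push_cast at h2
  linarith

theorem card_minimallyNonlinear_le {k : ℕ} (hk : 2 < k) (c : ℕ) :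
    (Finset.univ.filter fun P : Mat k c => MinimallyNonlinear P).card ≤
      (c ^ k - (c - 1) ^ k) * k ^ (c - 1) := by
  obtain _ | n := c
  · rw [Finset.card_eq_zero.2 (Finset.filter_eq_empty_iff.2 fun {P} _ h => ?_)]
    · exact Nat.zero_le _
    · have := h.transpose.card_columns_le
      omega
  · refine card_le_of_unique_nonfinal _ (fun P hP => ?_) (fun P hP => ?_) (fun P hP => ?_) <;>
    have h := (Finset.mem_filter.1 hP).2
    · exact h.exists_col
    · exact h.exists_row
    · rcases h.unobstructed_or with hU | hU
      · exact fun _ _ _ _ _ => hU.right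
      · omega

end ZeroOne

theorem mainTheorem3 (k : ℕ) (hk : 2 < k) :
    (ZeroOne.minimallyNonlinearWithRows k).Finite ∧
      (ZeroOne.minimallyNonlinearWithRows k).ncard ≤
        ∑ i ∈ Finset.Icc ⌈((k : ℚ) + 2) / 4⌉₊ (4 * k - 2),
          (i ^ k - (i - 1) ^ k) * k ^ (i - 1) := by
  set A : Finset (Σ c : ℕ, ZeroOne.Mat k c) :=
    (Finset.Icc ⌈((k : ℚ) + 2) / 4⌉₊ (4 * k - 2)).sigma fun c =>
      Finset.univ.filter fun P : ZeroOne.Mat k c => ZeroOne.MinimallyNonlinear P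
  have hA : ZeroOne.minimallyNonlinearWithRows k = A := by
    ext ⟨c, P⟩
    simp only [ZeroOne.minimallyNonlinearWithRows, Set.mem_ofPred_eq, A, Finset.coe_sigma,
      Set.mem_sigma_iff, Finset.mem_coe, Finset.mem_filter, Finset.mem_univ, true_and]
    exact ⟨fun h => ⟨h.mem_Icc hk, h⟩, fun h => h.2⟩
  rw [hA]
  refine ⟨A.finite_toSet, ?_⟩
  rw [Set.ncard_coe_finset, Finset.card_sigma]
  exact Finset.sum_le_sum fun c _ => ZeroOne.card_minimallyNonlinear_le hk c
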